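/- Let $\mathbb{K}$ be a field of characteristic zero, let $G$ be a (discrete) group, and let $\mathcal{F}$ be a non-empty family of finite subgroups of $G$, closed under conjugation and under taking subgroups. Let $\mathcal{H}_{\mathcal{F}}$ be the Hecke category over $\mathbb{K}$: its objects are the transitive $G$-sets $G/H$ with $H \in \mathcal{F}$, and the morphisms $G/H \to G/L$ are the $\mathbb{K}G$-module homomorphisms $\mathbb{K}[G/H] \to \mathbb{K}[G/L]$. An $\mathcal{H}_{\mathcal{F}}$-module is a $\mathbb{K}$-linear contravariant functor from $\mathcal{H}_{\mathcal{F}}$ to $\mathbb{K}$-modules; equivalently, a cohomological Mackey functor on $\mathcal{F}$. It is finitely generated if it is a quotient of a finite direct sum of modules $\operatorname{Hom}_{\mathcal{H}_{\mathcal{F}}}(-, G/H)$ with $H\in\mathcal{F}$. Let $\mathbb{K}^-$ be the fixed point functor of the trivial $\mathbb{K}G$-module, $G/H \mapsto \mathbb{K}^H = \operatorname{Hom}_{\mathbb{K}G}(\mathbb{K}[G/H], \mathbb{K})$, on which morphisms act by precomposition. Let $\mathcal{H}_{\mathcal{F}}\mathrm{cd}_{\mathbb{K}}\, G \in \mathbb{N}\cup\{\infty\}$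 be the length of the shortest projective resolution of $\mathbb{K}^-$ by $\mathcal{H}_{\mathcal{F}}$-modules, and let $\mathrm{cd}_{\mathbb{K}}\, G \in \mathbb{N}\cup\{\infty\}$ be the length of the shortest projective resolution of the trivial module $\mathbb{K}$ by $\mathbb{K}G$-modules. For $n \in \mathbb{N} \cup \{\infty\}$, say that $G$ is $\mathcal{H}_{\mathcal{F}}\mathrm{FP}_n$ over $\mathbb{K}$ (respectively $\mathrm{FP}_n$ over $\mathbb{K}G$) if $\mathbb{K}^-$ (respectively the trivial $\mathbb{K}G$-module $\mathbb{K}$) has a projective resolution which is finitely generated in every degree $i \le n$ (in every degree if $n=\infty$). Then $$\mathcal{H}_{\mathcal{F}}\mathrm{cd}_{\mathbb{K}}\, G = \mathrm{cd}_{\mathbb{K}}\, G,$$ and for every $n \in \mathbb{N}\cup\{\infty\}$, $G$ is $\mathcal{H}_{\mathcal{F}}\mathrm{FP}_n$ over $\mathbb{K}$ if and only if $G$ is $\mathrm{FP}_n$ over $\mathbb{K}G$. -/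

import Mathlib

open CategoryTheory CategoryTheory.Limits Opposite

noncomputable section

universe w v u

/-! ### Modules over a linear category -/

/-- A presheaf of `K`-modules on a `K`-linear category `C` is a (contravariant) `C`-module over `K`
if it is additive and `K`-linear on morphisms. -/
def isCatModule (K : Type u) [CommRing K] (C : Type v) [Category.{w} C] [Preadditive C]
    [Linear K C] : ObjectProperty (Cᵒᵖ ⥤ ModuleCat.{w} K) :=
  fun M => M.Additive ∧ ∀ (X Y : C) (f : X ⟶ Y) (r : K), M.map (r • f).op = r • M.map f.op

section

variable (K : Type u) [CommRing K] (C : Type v) [Category.{w} C] [Preadditive C] [Linear K C]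

/-- The category of contravariant `C`-modules over `K` and natural transformations. -/
abbrev CatModule : Type (max u v (w + 1)) := (isCatModule K C).FullSubcategory

variable {K C}

theorem isCatModule_of_injective {ι : Type*} {M : Cᵒᵖ ⥤ ModuleCat.{w} K}
    (N : ι → (Cᵒᵖ ⥤ ModuleCat.{w} K)) (hN : ∀ i, isCatModule K C (N i)) (p : ∀ i, M ⟶ N i)
    (hp : ∀ (X : Cᵒᵖ) (m m' : M.obj X), (∀ i, (p i).app X m = (p i).app X m') → m = m') :
    isCatModule K C M := by
  have nat : ∀ (i : ι) {X Y : Cᵒᵖ} (f : X ⟶ Y) (m : M.obj X),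
      (p i).app Y (M.map f m) = (N i).map f ((p i).app X m) :=
    fun i X Y f m => NatTrans.naturality_apply (p i) f m
  refine ⟨⟨fun {X Y f g} => ?_⟩, fun X Y f r => ?_⟩
  · ext m
    refine hp _ _ _ fun i => ?_
    have := (hN i).1
    simp [nat, Functor.map_add]
  · ext m
    refine hp _ _ _ fun i => ?_
    simp [nat, (hN i).2]

theorem isCatModule_of_surjective {M N : Cᵒᵖ ⥤ ModuleCat.{w} K} (hN : isCatModule K C N)
    (p : N ⟶ M) (hp : ∀ X : Cᵒᵖ, Function.Surjective (p.app X)) : isCatModule K C M := by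
  have nat : ∀ {X Y : Cᵒᵖ} (f : X ⟶ Y) (n : N.obj X),
      M.map f (p.app X n) = p.app Y (N.map f n) :=
    fun {X Y} f n => (NatTrans.naturality_apply p f n).symm
  refine ⟨⟨fun {X Y f g} => ?_⟩, fun X Y f r => ?_⟩
  · ext m
    obtain ⟨n, rfl⟩ := hp _ m
    have := hN.1
    change M.map (f + g) (p.app X n) = M.map f (p.app X n) + M.map g (p.app X n)
    rw [nat, nat, nat, N.map_add, ← map_add]
    rfl
  · ext m
    obtain ⟨n, rfl⟩ := hp _ m
    change M.map (r • f).op (p.app _ n) = r • M.map f.op (p.app _ n)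
    rw [nat, nat, hN.2, ← map_smul]
    rfl

instance : (isCatModule K C).IsClosedUnderSubobjects where
  prop_of_mono {M N} f hf hN := by
    refine isCatModule_of_injective (fun _ : Unit => N) (fun _ => hN) (fun _ => f)
      fun X m m' h => ?_
    have : Mono (f.app X) := inferInstance
    exact (ModuleCat.mono_iff_injective _).1 this (h ())

instance : (isCatModule K C).IsClosedUnderQuotients where
  prop_of_epi {N M} f hf hN := by
    refine isCatModule_of_surjective hN f fun X => ?_
    have : Epi (f.app X) := inferInstance
    exact (ModuleCat.epi_iff_surjective _).1 this

instance : (isCatModule K C).ContainsZero where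
  exists_zero := by
    have hZ := isZero_zero (Cᵒᵖ ⥤ ModuleCat.{w} K)
    refine ⟨_, hZ, isCatModule_of_injective (ι := Empty) (fun i => i.elim)
      (fun i => i.elim) (fun i => i.elim) fun X m m' _ => ?_⟩
    have h := hZ.obj X
    have := ModuleCat.subsingleton_of_isZero h
    exact Subsingleton.elim _ _

instance : (isCatModule K C).IsClosedUnderFiniteProducts where
  isClosedUnderLimitsOfShape J _ :=
    { limitsOfShape_le := by
        rintro M ⟨p⟩
        refine isCatModule_of_injective (fun j => p.diag.obj j) p.prop_diag_obj
          (fun j => p.π.app j) fun X m m' h => ?_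
        exact Concrete.isLimit_ext _ (isLimitOfPreserves ((evaluation _ _).obj X) p.isLimit) m m' h }

instance : HasFiniteBiproducts (CatModule K C) := Abelian.hasFiniteBiproducts

variable (K)

/-- The free `C`-module `K[-, x]_C` on one generator at `x`. -/
def freeCatModule (x : C) : CatModule K C where
  obj := (linearYoneda K C).obj x
  property := ⟨inferInstance, fun X Y f r => by
    ext g
    exact Linear.smul_comp _ _ _ r f g⟩

variable {K}

/-- A `C`-module is finitely generated if it is a quotient of a finite direct sum of modules of
the form `K[-, x]_C`. -/
def CatModule.FG (M : CatModule K C) : Prop :=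
  ∃ (n : ℕ) (x : Fin n → C) (π : (⨁ fun i => freeCatModule K (x i)) ⟶ M), Epi π

end

/-! ### Length and finiteness of projective resolutions -/

/-- The length of the shortest projective resolution of `X` (`⊤` if there is no finite one): the
least `n` such that `X` has a projective resolution which vanishes in all degrees above `n`. -/
def projDim {A : Type u} [Category.{v} A] [Abelian A] (X : A) : ℕ∞ :=
  ⨅ (n : ℕ) (_ : ∃ P : ProjectiveResolution X, ∀ i : ℕ, n < i → IsZero (P.complex.X i)), (n : ℕ∞)

/-- `X` has a projective resolution all of whose terms in degrees `≤ n` satisfy `fg`. For `n = ⊤`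
this is a condition on all the terms of one resolution. -/
def HasFPResolution {A : Type u} [Category.{v} A] [Abelian A] (fg : A → Prop) (n : ℕ∞) (X : A) :
    Prop :=
  ∃ P : ProjectiveResolution X, ∀ i : ℕ, (i : ℕ∞) ≤ n → fg (P.complex.X i)

/-! ### Families of finite subgroups and the Hecke category -/

/-- `F` is a nonempty family of finite subgroups of `G`, closed under conjugation and under passing
to subgroups. -/
structure IsFiniteSubgroupFamily {G : Type v} [Group G] (F : Set (Subgroup G)) : Prop where
  nonempty : F.Nonempty
  finite : ∀ H ∈ F, Finite H
  conj : ∀ H ∈ F, ∀ g : G, H.map (MulAut.conj g).toMonoidHom ∈ F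
  subgroup : ∀ H ∈ F, ∀ L : Subgroup G, L ≤ H → L ∈ F

section

variable (K : Type u) [CommRing K] {G : Type v} [Group G] (F : Set (Subgroup G))

/-- The Hecke category: its objects are the transitive `G`-sets `G ⧸ H` with `H` in `F`, and the
morphisms from `G ⧸ H` to `G ⧸ L` are the `K G`-module homomorphisms `K[G ⧸ H] → K[G ⧸ L]`. -/
abbrev HeckeCat : Type v :=
  InducedCategory (Rep.{max u v} K G) (fun H : F => Rep.ofMulAction K G (G ⧸ (H : Subgroup G)))

/-- The fixed point functor `M^-` of a representation `M` of `G`, as a module over the Hecke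
category: its value at `G ⧸ H` is `M^H`, in the form `Hom_{KG}(K[G ⧸ H], M)`, and a morphism of the
Hecke category acts by precomposition. -/
def fixedPointModule (M : Rep.{max u v} K G) : CatModule K (HeckeCat K F) where
  obj := (inducedFunctor _).op ⋙ (linearYoneda K (Rep.{max u v} K G)).obj M
  property := ⟨inferInstance, fun X Y f r => by
    ext g
    exact Linear.smul_comp _ _ _ r f.hom g⟩

/-- The module `K^-`: the fixed point functor of the trivial representation `K`. -/
abbrev constHeckeModule : CatModule K (HeckeCat K F) :=
  fixedPointModule K F (Rep.trivial K G (ULift.{v} K))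

/-- The cohomological dimension of `G` over `K` for cohomological Mackey functors, i.e. for modules
over the Hecke category: the length of the shortest projective resolution of `K^-`. -/
def heckeCd : ℕ∞ := projDim (constHeckeModule K F)

/-- The condition `H_F-FP_n` over `K`: the module `K^-` over the Hecke category has a projective
resolution which is finitely generated in all degrees up to `n`. -/
def IsHeckeFP (n : ℕ∞) : Prop := HasFPResolution CatModule.FG n (constHeckeModule K F)

end

/-! ### The classical conditions over the group algebra -/

section

variable (K : Type u) [CommRing K] (G : Type v) [Group G]

/-- `K` with trivial `G`-action, as a module over the group algebra `K G`. -/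
abbrev trivialGroupModule : ModuleCat.{max u v} (MonoidAlgebra K G) :=
  ModuleCat.of (MonoidAlgebra K G) (Representation.trivial K G (ULift.{v} K)).asModule

/-- The cohomological dimension `cd_K G`: the length of the shortest projective resolution of the
trivial module `K` over `K G`. -/
def groupCd : ℕ∞ := projDim (trivialGroupModule K G)

/-- The condition `FP_n` over `K G`: the trivial module `K` has a projective resolution which is
finitely generated in all degrees up to `n`. -/
def IsGroupFP (n : ℕ∞) : Prop :=
  HasFPResolution
    (fun M : ModuleCat.{max u v} (MonoidAlgebra K G) => Module.Finite (MonoidAlgebra K G) M)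
    n (trivialGroupModule K G)

end

end

/-! The family contains the trivial subgroup. For a finite group `H`, the order of `H` is invertible
in a field of characteristic zero, so averaging over `H` makes `K[G ⧸ H]` a retract of `K[G ⧸ ⊥]`,
the free `KG`-module of rank one. Every object of the Hecke category is thus a retract of `G ⧸ ⊥`,
and a Hecke module `M` is determined by its value there together with the translation action of `G`:
`M(G ⧸ H)` is `Hom_{KG}(K[G ⧸ H], M(G ⧸ ⊥))` (`CatModule.toEvalHom_bijective`).

Evaluation at `G ⧸ ⊥` is therefore an equivalence with `KG`-modules, inverse to the fixed point
functor, and it sends `K^-` to `K`. It matches the two notions of finite generation, so it carries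
resolutions of either kind to resolutions of the other. -/

noncomputable section

/-! ### Transport of projective resolutions along an equivalence -/

section

variable {A : Type*} [Category* A] [Abelian A] {B : Type*} [Category* B] [Abelian B]

/-- An additive equivalence carries projective resolutions to projective resolutions; only the
augmentation has to be corrected by `i`. -/
theorem HasFPResolution.of_equivalence (e : A ≌ B) [e.functor.Additive] {p : A → Prop}
    {q : B → Prop} (hpq : ∀ X, p X → q (e.functor.obj X)) {n : ℕ∞} {X : A} {Y : B}
    (i : e.functor.obj X ≅ Y) (h : HasFPResolution p n X) : HasFPResolution q n Y := by
  obtain ⟨P, hP⟩ := h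
  let Q := e.functor.mapProjectiveResolution P
  exact ⟨{ complex := Q.complex
           projective := Q.projective
           π := Q.π ≫ (ChainComplex.single₀ B).map i.hom }, fun j hj => hpq _ (hP j hj)⟩

theorem projDim_le_of_equivalence (e : A ≌ B) [e.functor.Additive] {X : A} {Y : B}
    (i : e.functor.obj X ≅ Y) : projDim Y ≤ projDim X := by
  refine le_iInf₂ fun n ⟨P, hP⟩ => iInf₂_le n ?_
  let Q := e.functor.mapProjectiveResolution P
  exact ⟨{ complex := Q.complex
           projective := Q.projective
           π := Q.π ≫ (ChainComplex.single₀ B).map i.hom },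
    fun j hj => e.functor.map_isZero (hP j hj)⟩

end

/-! ### Permutation modules and averaging -/

section

variable {K : Type u} [CommRing K] {G : Type v} [Group G]

/-- The morphism of representations `K[G ⧸ H] ⟶ A` which sends the coset of `1` to a given
`H`-invariant vector. -/
def Rep.ofQuotientHom (H : Subgroup G) (A : Rep.{max u v} K G) (a : A)
    (ha : ∀ h ∈ H, A.ρ h a = a) : Rep.ofMulAction K G (G ⧸ H) ⟶ A :=
  Rep.ofHom ⟨Finsupp.linearCombination K (fun q : G ⧸ H => Quotient.liftOn' q (fun g => A.ρ g a)
      fun g g' h => by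
        rw [QuotientGroup.leftRel_apply] at h
        change A.ρ g a = A.ρ g' a
        -- Since `g⁻¹ * g'` lies in `H`, it fixes `a` and can be inserted to turn `g` into `g'`.
        rw [← ha _ h, ← Module.End.mul_apply, ← map_mul, mul_inv_cancel_left, ha _ h]) ∘ₗ
      (MonoidAlgebra.coeffLinearEquiv K).toLinearMap, fun g => by
    ext q
    induction q using QuotientGroup.induction_on with
    | H g' => simp⟩

theorem Rep.ofQuotientHom_single_mk (H : Subgroup G) (A : Rep.{max u v} K G) (a : A)
    (ha : ∀ h ∈ H, A.ρ h a = a) (g : G) (r : K) :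
    (Rep.ofQuotientHom H A a ha).hom (MonoidAlgebra.single (g : G ⧸ H) r) = r • A.ρ g a := by
  simp [Rep.ofQuotientHom]

theorem Rep.ofQuotientHom_single_one (H : Subgroup G) (A : Rep.{max u v} K G) (a : A)
    (ha : ∀ h ∈ H, A.ρ h a = a) :
    (Rep.ofQuotientHom H A a ha).hom (MonoidAlgebra.single ((1 : G) : G ⧸ H) 1) = a := by
  simp [Rep.ofQuotientHom]

theorem Representation.ofMulAction_quotient_single_mk (H : Subgroup G) (g g' : G) (r : K) :
    Representation.ofMulAction K G (G ⧸ H) g (MonoidAlgebra.single (g' : G ⧸ H) r) =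
      MonoidAlgebra.single ((g * g' : G) : G ⧸ H) r :=
  Representation.ofMulAction_single _ _ _

/-- The coset of `1` generates `K[G ⧸ H]` over `KG`. -/
theorem Rep.ofQuotient_hom_ext {H : Subgroup G} {A : Rep.{max u v} K G}
    {f f' : Rep.ofMulAction K G (G ⧸ H) ⟶ A}
    (h : f.hom (MonoidAlgebra.single ((1 : G) : G ⧸ H) 1) =
      f'.hom (MonoidAlgebra.single ((1 : G) : G ⧸ H) 1)) : f = f' := by
  ext q
  induction q using QuotientGroup.induction_on with
  | H g =>
    have := congrArg (A.ρ g) h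
    rw [← Rep.hom_comm_apply, ← Rep.hom_comm_apply] at this
    simpa using this
end

section

variable {K : Type u} [Field K] [CharZero K] {G : Type v} [Group G]

/-- If `H` is finite, then `K[G ⧸ H]` is a retract of `K[G ⧸ ⊥]`. -/
theorem Rep.exists_section_ofMulAction_quotient (H : Subgroup G) [Finite H] :
    ∃ (s : Rep.ofMulAction K G (G ⧸ H) ⟶ Rep.ofMulAction K G (G ⧸ (⊥ : Subgroup G)))
      (p : Rep.ofMulAction K G (G ⧸ (⊥ : Subgroup G)) ⟶ Rep.ofMulAction K G (G ⧸ H)),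
      s ≫ p = 𝟙 _ := by
  have := Fintype.ofFinite H
  -- The average of `H`: it is `H`-invariant because left multiplication permutes `H`, so it defines
  -- the section `s`.
  let a : Rep.ofMulAction K G (G ⧸ (⊥ : Subgroup G)) :=
    (Fintype.card H : K)⁻¹ • ∑ h : H, MonoidAlgebra.single (((h : G) : G ⧸ (⊥ : Subgroup G))) 1
  refine ⟨Rep.ofQuotientHom H _ a fun g hg => ?_, Rep.ofQuotientHom ⊥ _
    (MonoidAlgebra.single ((1 : G) : G ⧸ H) 1) fun h hh => ?_, Rep.ofQuotient_hom_ext ?_⟩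
  · simp only [a, map_smul, map_sum, Representation.ofMulAction_single]
    congr 1
    exact Fintype.sum_equiv (Equiv.mulLeft (⟨g, hg⟩ : H)) _ _ fun h => rfl
  · obtain rfl := Subgroup.mem_bot.1 hh
    simp
  · rw [Rep.hom_comp, Representation.IntertwiningMap.comp_apply, Rep.ofQuotientHom_single_one,
      map_smul, map_sum]
    -- Each of the `|H|` terms of the average projects to the coset of `1`, and the factor `|H|⁻¹`
    -- compensates.
    have hc (g : H) (ha) :
        (Rep.ofQuotientHom ⊥ (Rep.ofMulAction K G (G ⧸ H)) (MonoidAlgebra.single ((1 : G) : G ⧸ H) 1)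
          ha).hom (MonoidAlgebra.single ((g : G) : G ⧸ (⊥ : Subgroup G)) 1) =
          MonoidAlgebra.single ((1 : G) : G ⧸ H) 1 := by
      refine (Rep.ofQuotientHom_single_mk _ _ _ ha _ _).trans ?_
      rw [one_smul]
      refine (Representation.ofMulAction_quotient_single_mk _ _ _ _).trans ?_
      congr 1
      exact QuotientGroup.eq.2 (by simp)
    simp_rw [hc]
    simp
end

/-! ### Hecke modules near `G ⧸ ⊥` and the evaluation functor -/

section

variable {K : Type u} [CommRing K] {G : Type v} [Group G] {F : Set (Subgroup G)}
  (h : ⊥ ∈ F)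

namespace HeckeCat

/-- The object `G ⧸ ⊥` of the Hecke category. -/
abbrev free : HeckeCat K F := (⟨⊥, h⟩ : F)

/-- The morphism `K[G ⧸ ⊥] ⟶ K[G ⧸ H]` given by an element of the target. -/
def homOf (x : HeckeCat K F) (z : MonoidAlgebra K (G ⧸ x.1)) : free h ⟶ x :=
  InducedCategory.homMk (Rep.ofQuotientHom ⊥ _ z fun g hg => by
    obtain rfl := Subgroup.mem_bot.1 hg
    simp)

/-- The value of a morphism out of `K[G ⧸ ⊥]` at the coset of `1`. -/
def value {x : HeckeCat K F} (f : free h ⟶ x) : MonoidAlgebra K (G ⧸ x.1) :=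
  f.hom.hom (MonoidAlgebra.single ((1 : G) : G ⧸ (⊥ : Subgroup G)) 1)

variable {h}

@[simp]
theorem value_homOf (x : HeckeCat K F) (z : MonoidAlgebra K (G ⧸ x.1)) :
    value h (homOf h x z) = z :=
  Rep.ofQuotientHom_single_one _ _ _ (by simp [Subgroup.mem_bot])

theorem value_injective {x : HeckeCat K F} {f f' : free h ⟶ x} (hf : value h f = value h f') :
    f = f' :=
  InducedCategory.hom_ext (Rep.ofQuotient_hom_ext hf)

@[simp]
theorem homOf_value {x : HeckeCat K F} (f : free h ⟶ x) : homOf h x (value h f) = f :=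
  value_injective (value_homOf _ _)

theorem homOf_add (x : HeckeCat K F) (z z' : MonoidAlgebra K (G ⧸ x.1)) :
    homOf h x (z + z') = homOf h x z + homOf h x z' := by
  refine value_injective ((value_homOf _ _).trans ?_)
  exact (congrArg₂ (· + ·) (value_homOf x z) (value_homOf x z')).symm

theorem homOf_smul (x : HeckeCat K F) (r : K) (z : MonoidAlgebra K (G ⧸ x.1)) :
    homOf h x (r • z) = r • homOf h x z := by
  refine value_injective ((value_homOf _ _).trans ?_)
  exact (congrArg (r • ·) (value_homOf x z)).symm

theorem homOf_comp {x y : HeckeCat K F} (z : MonoidAlgebra K (G ⧸ x.1)) (f : x ⟶ y) :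
    homOf h x z ≫ f = homOf h y (f.hom.hom z) := by
  refine value_injective (Eq.trans ?_ (value_homOf _ _).symm)
  exact congrArg f.hom.hom (value_homOf x z)

variable (K h) in
/-- Right translation by an element of `G`, as an endomorphism of `K[G ⧸ ⊥]`. -/
def translate (g : G) : free (K := K) h ⟶ free h :=
  homOf h (free h) (MonoidAlgebra.single (g : G ⧸ (⊥ : Subgroup G)) 1)

/-- By equivariance, `f` sends the coset of `g` to `g` times its value at the coset of `1`. -/
theorem translate_comp (g : G) {x : HeckeCat K F} (f : free h ⟶ x) :
    translate K h g ≫ f = homOf h x (Representation.ofMulAction K G (G ⧸ (x.1 : Subgroup G)) g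
      (value h f)) := by
  rw [translate, homOf_comp]
  congr 1
  refine Eq.trans ?_ (Rep.hom_comm_apply f.hom g _)
  refine congrArg _ (Eq.trans ?_ (Representation.ofMulAction_quotient_single_mk ⊥ g 1 1).symm)
  rw [mul_one]

theorem translate_one : translate K h 1 = 𝟙 _ :=
  value_injective (value_homOf _ _)

/-- Right translations compose in diagrammatic order, so a contravariant module turns them into a
left action of `G`, with no inverses. -/
theorem translate_mul (g g' : G) : translate K h (g * g') = translate K h g ≫ translate K h g' := by
  rw [translate_comp, translate, translate, value_homOf]
  congr 1
  exact (Representation.ofMulAction_quotient_single_mk _ _ _ _).symm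

end HeckeCat

namespace CatModule

variable (M : CatModule K (HeckeCat K F))

/-- The action of a morphism on a module over the Hecke category. -/
def act {x y : HeckeCat K F} (f : x ⟶ y) : M.obj.obj (op y) →ₗ[K] M.obj.obj (op x) :=
  (M.obj.map f.op).hom

theorem act_add {x y : HeckeCat K F} (f f' : x ⟶ y) : M.act (f + f') = M.act f + M.act f' := by
  have := M.property.1
  exact congrArg ModuleCat.Hom.hom (M.obj.map_add (f := f.op) (g := f'.op))

theorem act_smul {x y : HeckeCat K F} (r : K) (f : x ⟶ y) : M.act (r • f) = r • M.act f :=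
  congrArg ModuleCat.Hom.hom (M.property.2 _ _ f r)

theorem act_id (x : HeckeCat K F) : M.act (𝟙 x) = LinearMap.id :=
  congrArg ModuleCat.Hom.hom (M.obj.map_id (op x))

theorem act_comp {x y z : HeckeCat K F} (f : x ⟶ y) (f' : y ⟶ z) (m : M.obj.obj (op z)) :
    M.act (f ≫ f') m = M.act f (M.act f' m) :=
  congrArg (fun φ => φ.hom m) (M.obj.map_comp f'.op f.op)

theorem act_naturality {M N : CatModule K (HeckeCat K F)} (α : M ⟶ N) {x y : HeckeCat K F}
    (f : x ⟶ y) (m : M.obj.obj (op y)) :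
    (α.hom.app (op x)).hom (M.act f m) = N.act f ((α.hom.app (op y)).hom m) :=
  congrArg (fun φ => φ.hom m) (α.hom.naturality f.op)

end CatModule

open HeckeCat

/-- Evaluation at `G ⧸ ⊥`, as a functor from modules over the Hecke category to
representations. -/
def heckeEval : CatModule K (HeckeCat K F) ⥤ Rep.{max u v} K G where
  obj M := Rep.of (X := M.obj.obj (op (free h)))
    { toFun g := M.act (translate K h g)
      map_one' := by rw [translate_one, M.act_id]; rfl
      map_mul' g g' := by
        ext m
        rw [translate_mul, M.act_comp]; rfl }
  map α := Rep.ofHom ⟨(α.hom.app (op (free h))).hom, fun g => by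
    ext m
    exact CatModule.act_naturality α _ m⟩

instance : (heckeEval (K := K) h).Additive where

/-- The fixed point functor, as a functor from representations to modules over the Hecke
category. -/
def fixedPointFunctor (K : Type u) [CommRing K] {G : Type v} [Group G] (F : Set (Subgroup G)) :
    Rep.{max u v} K G ⥤ CatModule K (HeckeCat K F) where
  obj M := fixedPointModule K F M
  map f := ObjectProperty.homMk (Functor.whiskerLeft (inducedFunctor _).op
    ((linearYoneda K (Rep.{max u v} K G)).map f))

end

/-! ### Equivalence between Hecke modules and representations -/

section

variable {K : Type u} [CommRing K] {G : Type v} [Group G] {F : Set (Subgroup G)}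
  (h : ⊥ ∈ F)

open HeckeCat

/-- An element of `M(G ⧸ H)` gives an equivariant map `K[G ⧸ H] ⟶ M(G ⧸ ⊥)`. -/
def CatModule.toEvalHom (M : CatModule K (HeckeCat K F)) (x : HeckeCat K F) :
    M.obj.obj (op x) →ₗ[K] (Rep.ofMulAction K G (G ⧸ (x.1 : Subgroup G)) ⟶ (heckeEval h).obj M) where
  toFun m := Rep.ofHom
    ⟨{  toFun z := M.act (homOf h x z) m
        map_add' z z' := by rw [homOf_add, M.act_add]; rfl
        map_smul' r z := by rw [homOf_smul, M.act_smul]; rfl }, fun g => by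
      ext z
      change M.act (homOf h x _) m = M.act (translate K h g) (M.act (homOf h x _) m)
      rw [← M.act_comp, translate_comp, value_homOf]⟩
  map_add' m m' := by
    ext z
    exact map_add (M.act _) _ _
  map_smul' r m := by
    ext z
    exact map_smul (M.act _) _ _

theorem CatModule.toEvalHom_apply (M : CatModule K (HeckeCat K F)) (x : HeckeCat K F)
    (m : M.obj.obj (op x)) (z : MonoidAlgebra K (G ⧸ x.1)) :
    (M.toEvalHom h x m).hom z = M.act (homOf h x z) m := rfl

theorem CatModule.toEvalHom_act (M : CatModule K (HeckeCat K F)) {x y : HeckeCat K F} (f : x ⟶ y)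
    (m : M.obj.obj (op y)) : M.toEvalHom h x (M.act f m) = f.hom ≫ M.toEvalHom h y m := by
  apply Rep.hom_ext
  apply DFunLike.ext
  intro z
  change M.act _ _ = M.act _ _
  rw [← M.act_comp, homOf_comp]
  rfl

/-- An element `m` is recovered as `s` acting on `p` acting on `m`, and the latter is a value of the
associated map. This also dictates the preimage of a given `f`. -/
theorem CatModule.toEvalHom_bijective (M : CatModule K (HeckeCat K F)) {x : HeckeCat K F}
    {s : x ⟶ free h} {p : free h ⟶ x} (hsp : s ≫ p = 𝟙 x) :
    Function.Bijective (M.toEvalHom h x) := by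
  refine ⟨fun m m' hm => ?_, fun f => ?_⟩
  · have := congrArg (fun φ => φ.hom (value h p)) hm
    simp only [M.toEvalHom_apply, homOf_value] at this
    have := congrArg (M.act s) this
    rwa [← M.act_comp, ← M.act_comp, hsp, M.act_id] at this
  · refine ⟨M.act s (f.hom (value h p)), ?_⟩
    -- At `G ⧸ ⊥` itself both maps agree on the coset of `1`; precomposing with `s` then gives `s ≫
    -- p ≫ f = f`.
    have key : M.toEvalHom h (free h) (f.hom (value h p)) = p.hom ≫ f := by
      refine Rep.ofQuotient_hom_ext ?_
      refine Eq.trans (b := M.act (𝟙 _) (f.hom (value h p))) ?_ ?_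
      · rw [← translate_one]; rfl
      · rw [M.act_id]; rfl
    refine ((M.toEvalHom_act h s _).trans (congrArg (s.hom ≫ ·) key)).trans ?_
    refine (Category.assoc _ _ _).symm.trans ?_
    exact (congrArg (· ≫ f) (congrArg (fun φ : x ⟶ x => φ.hom) hsp)).trans
      (Category.id_comp f)

/-- A representation is recovered from its fixed point functor by evaluation. -/
def heckeEvalFixedPointIso (M : Rep.{max u v} K G) :
    (heckeEval h).obj ((fixedPointFunctor K F).obj M) ≅ M :=
  Rep.mkIso
    (ρ := ((heckeEval h).obj ((fixedPointFunctor K F).obj M)).ρ) (σ := M.ρ) <| .mk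
    { toFun f := f.hom (MonoidAlgebra.single ((1 : G) : G ⧸ (⊥ : Subgroup G)) 1)
      map_add' f f' := rfl
      map_smul' r f := rfl
      invFun m := Rep.ofQuotientHom ⊥ M m (by simp [Subgroup.mem_bot])
      left_inv f := Rep.ofQuotient_hom_ext (Rep.ofQuotientHom_single_one _ _ _ _)
      right_inv m := Rep.ofQuotientHom_single_one _ _ _ _ } fun g => by
    ext f
    refine (congrArg f.hom ((value_homOf (h := h) (free h) _).trans ?_)).trans
      (Rep.hom_comm_apply f g _)
    refine Eq.trans ?_ (Representation.ofMulAction_quotient_single_mk ⊥ g 1 1).symm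
    rw [mul_one]

/-- If every `K[G ⧸ H]` is a retract of `K[G ⧸ ⊥]`, then a module over the Hecke category is the
fixed point functor of its evaluation. -/
def fixedPointHeckeEvalIso
    (hs : ∀ x : HeckeCat K F, ∃ (s : x ⟶ free h) (p : free h ⟶ x), s ≫ p = 𝟙 x)
    (M : CatModule K (HeckeCat K F)) :
    M ≅ (fixedPointFunctor K F).obj ((heckeEval h).obj M) :=
  ObjectProperty.isoMk _ (NatIso.ofComponents (fun x => LinearEquiv.toModuleIso
      (LinearEquiv.ofBijective (M.toEvalHom h x.unop) (by
        obtain ⟨s, p, hsp⟩ := hs x.unop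
        exact M.toEvalHom_bijective h hsp))) fun {x y} f => by
    ext m
    exact M.toEvalHom_act h f.unop m)

/-- If every `K[G ⧸ H]` is a retract of `K[G ⧸ ⊥]`, then evaluation at `G ⧸ ⊥` is an equivalence
between modules over the Hecke category and representations. -/
def heckeEvalEquivalence
    (hs : ∀ x : HeckeCat K F, ∃ (s : x ⟶ free h) (p : free h ⟶ x), s ≫ p = 𝟙 x) :
    CatModule K (HeckeCat K F) ≌ Rep.{max u v} K G :=
  CategoryTheory.Equivalence.mk (heckeEval h) (fixedPointFunctor K F)
    (NatIso.ofComponents (fixedPointHeckeEvalIso h hs) fun {M N} α => by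
      apply ObjectProperty.hom_ext
      ext x m
      apply Rep.hom_ext
      apply DFunLike.ext
      intro z
      exact (CatModule.act_naturality α _ m).symm)
    (NatIso.ofComponents (heckeEvalFixedPointIso h) fun {M N} α => rfl)

end

/-! ### Comparison of finite generation -/

section

variable {K : Type u} [CommRing K] {G : Type v} [Group G] {F : Set (Subgroup G)}
  (h : ⊥ ∈ F)

open HeckeCat

instance : (Rep.toModuleMonoidAlgebra.{max u v} (k := K) (G := G)).Additive where

/-- If every `K[G ⧸ H]` is a retract of `K[G ⧸ ⊥]`, then evaluation at `G ⧸ ⊥` is an equivalence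
between modules over the Hecke category and modules over the group algebra. -/
def heckeEquivalence
    (hs : ∀ x : HeckeCat K F, ∃ (s : x ⟶ free h) (p : free h ⟶ x), s ≫ p = 𝟙 x) :
    CatModule K (HeckeCat K F) ≌ ModuleCat.{max u v} (MonoidAlgebra K G) :=
  (heckeEvalEquivalence h hs).trans Rep.equivalenceModuleMonoidAlgebra

/-- Evaluation at `G ⧸ ⊥`, as a functor to modules over the group algebra. -/
abbrev heckeEvalModule : CatModule K (HeckeCat K F) ⥤ ModuleCat.{max u v} (MonoidAlgebra K G) :=
  heckeEval h ⋙ Rep.toModuleMonoidAlgebra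

/-- An element of `M(G ⧸ ⊥)`, as an element of the associated module over the group algebra. -/
def CatModule.toModule (M : CatModule K (HeckeCat K F)) :
    M.obj.obj (op (free h)) ≃+ (heckeEvalModule h).obj M :=
  ((heckeEval h).obj M).ρ.asModuleEquiv.symm.toAddEquiv

theorem CatModule.single_smul_toModule (M : CatModule K (HeckeCat K F)) (g : G) (r : K)
    (m : M.obj.obj (op (free h))) :
    (MonoidAlgebra.single g r : MonoidAlgebra K G) • M.toModule h m =
      M.toModule h (r • M.act (translate K h g) m) := by
  have := ((heckeEval h).obj M).ρ.asModuleEquiv_map_smul (MonoidAlgebra.single g r) (M.toModule h m)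
  rw [Representation.asAlgebraHom_single] at this
  exact this

theorem heckeEvalModule_map_toModule {M N : CatModule K (HeckeCat K F)} (α : M ⟶ N)
    (m : M.obj.obj (op (free h))) :
    ((heckeEvalModule h).map α).hom (M.toModule h m) =
      N.toModule h ((α.hom.app (op (free h))).hom m) := rfl

/-- The evaluation of a free module over the Hecke category is cyclic. -/
theorem finite_heckeEvalModule_freeCatModule (x : HeckeCat K F) :
    Module.Finite (MonoidAlgebra K G) ((heckeEvalModule h).obj (freeCatModule K x)) := by
  refine ⟨{(freeCatModule K x).toModule h (homOf h x (MonoidAlgebra.single ((1 : G) : G ⧸ x.1) 1))},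
    ?_⟩
  refine (congrArg _ (Finset.coe_singleton _)).trans (eq_top_iff.2 ?_)
  rintro m -
  obtain ⟨f, rfl⟩ := ((freeCatModule K x).toModule h).surjective m
  obtain ⟨z, rfl⟩ : ∃ z, homOf h x z = f := ⟨_, homOf_value f⟩
  -- The span is additive, so it suffices to treat `r` times the coset of `g`, which is `single g r`
  -- applied to the generator.
  induction z using MonoidAlgebra.induction_linear with
  | zero =>
    have : homOf h x (0 : MonoidAlgebra K (G ⧸ x.1)) = 0 := by
      simpa using homOf_smul (h := h) x (0 : K) 0
    rw [this]
    exact (map_zero ((freeCatModule K x).toModule h)).symm ▸ zero_mem _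
  | add z z' hz hz' =>
    rw [homOf_add]
    exact (map_add ((freeCatModule K x).toModule h) _ _).symm ▸ add_mem hz hz'
  | single q r =>
    induction q using QuotientGroup.induction_on with
    | H g =>
      refine Submodule.mem_span_singleton.2 ⟨MonoidAlgebra.single g r, ?_⟩
      refine (CatModule.single_smul_toModule h _ _ _ _).trans (congrArg _ ?_)
      change r • (translate K h g ≫ _) = _
      rw [translate_comp, value_homOf, Representation.ofMulAction_quotient_single_mk, ← homOf_smul,
        MonoidAlgebra.smul_single, smul_eq_mul, mul_one, mul_one]

theorem CatModule.FG.finite_heckeEvalModule {M : CatModule K (HeckeCat K F)} (hM : M.FG)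
    (hs : ∀ x : HeckeCat K F, ∃ (s : x ⟶ free h) (p : free h ⟶ x), s ≫ p = 𝟙 x) :
    Module.Finite (MonoidAlgebra K G) ((heckeEvalModule h).obj M) := by
  obtain ⟨n, x, π, hπ⟩ := hM
  have : (heckeEvalModule h).IsEquivalence := (heckeEquivalence h hs).isEquivalence_functor
  have hπ' := (ModuleCat.epi_iff_surjective _).1
    (inferInstance : Epi ((heckeEvalModule h).map π))
  have hfin (i : Fin n) := finite_heckeEvalModule_freeCatModule h (x i)
  let f : (∀ i, (heckeEvalModule h).obj (freeCatModule K (x i))) →ₗ[MonoidAlgebra K G]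
      (heckeEvalModule h).obj M :=
    ∑ i, ((heckeEvalModule h).map (biproduct.ι (fun i => freeCatModule K (x i)) i ≫ π)).hom ∘ₗ
      LinearMap.proj i
  refine Module.Finite.of_surjective f fun m => ?_
  obtain ⟨m, rfl⟩ := hπ' m
  -- The preimage is the tuple of biproduct components of `m`, as the identity is the sum of the `π
  -- i ≫ ι i`.
  refine ⟨fun i => ((heckeEvalModule h).map (biproduct.π _ i)).hom m, ?_⟩
  have := congrArg (fun φ => ((heckeEvalModule h).map (φ ≫ π)).hom m)
    (biproduct.total (f := fun i => freeCatModule K (x i)))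
  simp only [Preadditive.sum_comp, Functor.map_sum, Category.id_comp, ModuleCat.hom_sum,
    LinearMap.sum_apply] at this
  rw [← this, LinearMap.sum_apply]
  refine Finset.sum_congr rfl fun i _ => ?_
  rw [Category.assoc, Functor.map_comp _ (biproduct.π _ i)]
  rfl

/-- The morphism from a free module given by an element. -/
def CatModule.ofElement (M : CatModule K (HeckeCat K F)) {x : HeckeCat K F}
    (m : M.obj.obj (op x)) : freeCatModule K x ⟶ M :=
  ObjectProperty.homMk
    { app y := ModuleCat.ofHom (Y := M.obj.obj y)
        { toFun f := M.act f m
          map_add' f f' := by rw [M.act_add]; rfl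
          map_smul' r f := by rw [M.act_smul]; rfl }
      naturality y y' f := by
        ext f'
        exact M.act_comp f.unop f' m }

theorem CatModule.fg_of_finite_heckeEvalModule {M : CatModule K (HeckeCat K F)}
    (hs : ∀ x : HeckeCat K F, ∃ (s : x ⟶ free h) (p : free h ⟶ x), s ≫ p = 𝟙 x)
    (hM : Module.Finite (MonoidAlgebra K G) ((heckeEvalModule h).obj M)) : M.FG := by
  obtain ⟨n, a, ha⟩ := Module.Finite.exists_fin (R := MonoidAlgebra K G)
    (M := (heckeEvalModule h).obj M)
  have : (heckeEvalModule h).IsEquivalence := (heckeEquivalence h hs).isEquivalence_functor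
  let m (i : Fin n) := (M.toModule h).symm (a i)
  refine ⟨n, fun _ => free h, biproduct.desc fun i => M.ofElement (m i), ?_⟩
  refine (heckeEvalModule h).epi_of_epi_map ((ModuleCat.epi_iff_surjective _).2 ?_)
  rw [← LinearMap.range_eq_top, eq_top_iff, ← ha, Submodule.span_le]
  rintro _ ⟨i, rfl⟩
  -- The generator `a i` is the image of the identity of `G ⧸ ⊥` in the `i`-th summand.
  have := congrArg (fun φ => ((heckeEvalModule h).map φ).hom
    ((freeCatModule K (free h)).toModule h (𝟙 (free h))))
    (biproduct.ι_desc (fun i => M.ofElement (m i)) i)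
  simp only [Functor.map_comp] at this
  refine ⟨_, this.trans ((heckeEvalModule_map_toModule h _ _).trans ?_)⟩
  exact (M.toModule h).eq_symm_apply.1 (congrArg (fun φ => φ (m i)) (M.act_id (free h)))

/-- The evaluation of `K^-` is the trivial module. -/
def heckeEvalModuleConstIso :
    (heckeEvalModule h).obj (constHeckeModule K F) ≅ trivialGroupModule K G :=
  Rep.toModuleMonoidAlgebra.mapIso (heckeEvalFixedPointIso h (Rep.trivial K G (ULift.{v} K)))

end

/-! ### Conclusion in characteristic zero -/

theorem HeckeCat.exists_section {K : Type u} [Field K] [CharZero K] {G : Type v} [Group G]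
    {F : Set (Subgroup G)} (hF : IsFiniteSubgroupFamily F) (h : ⊥ ∈ F) (x : HeckeCat K F) :
    ∃ (s : x ⟶ free h) (p : free h ⟶ x), s ≫ p = 𝟙 x := by
  have := hF.finite x.1 x.2
  obtain ⟨s, p, hsp⟩ := Rep.exists_section_ofMulAction_quotient (K := K) (x.1 : Subgroup G)
  exact ⟨InducedCategory.homMk s, InducedCategory.homMk p, InducedCategory.hom_ext hsp⟩

end

theorem mainTheorem10 {K : Type*} [Field K] [CharZero K] {G : Type*} [Group G]
    (F : Set (Subgroup G)) (hF : IsFiniteSubgroupFamily F) :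
    heckeCd K F = groupCd K G ∧ ∀ n : ℕ∞, IsHeckeFP K F n ↔ IsGroupFP K G n := by
  obtain ⟨H, hH⟩ := hF.nonempty
  have h : ⊥ ∈ F := hF.subgroup H hH ⊥ bot_le
  have hs := HeckeCat.exists_section (K := K) hF h
  let e := heckeEquivalence h hs
  have : e.functor.Additive := inferInstanceAs (heckeEvalModule h).Additive
  have : e.symm.functor.Additive := e.inverse_additive
  let i : e.functor.obj (constHeckeModule K F) ≅ trivialGroupModule K G := heckeEvalModuleConstIso h
  let j : e.symm.functor.obj (trivialGroupModule K G) ≅ constHeckeModule K F :=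
    e.inverse.mapIso i.symm ≪≫ (e.unitIso.app _).symm
  refine ⟨le_antisymm (projDim_le_of_equivalence e.symm j) (projDim_le_of_equivalence e i),
    fun n => ⟨.of_equivalence e (fun M hM => hM.finite_heckeEvalModule h hs) i,
      .of_equivalence e.symm (fun N hN => ?_) j⟩⟩
  -- Evaluating the Hecke module attached to `N` returns `N` up to the counit.
  refine CatModule.fg_of_finite_heckeEvalModule h hs ?_
  have : Module.Finite (MonoidAlgebra K G) ((𝟭 (ModuleCat (MonoidAlgebra K G))).obj N) := hN
  exact Module.Finite.equiv (e.counitIso.app N).toLinearEquiv.symm
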